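/- Let $K$ be a field of characteristic zero. Let $\mathbb{I}_1 = K\langle x, \frac{d}{dx}, \int\rangle$ be the algebra of polynomial integro-differential operators, i.e. the unital $K$-subalgebra of $\mathrm{End}_K(K[x])$ generated by multiplication by $x$, the derivation $\frac{d}{dx}$, and the integration map $\int : x^n \mapsto \frac{x^{n+1}}{n+1}$ ($n \ge 0$, extended $K$-linearly). Call a finitely generated module coherent if each of its finitely generated submodules is finitely presented, and call a ring $R$ left (resp. right) coherent if $R$ is coherent as a left (resp. right) module over itself. Then $\mathbb{I}_1$ is a left coherent and a right coherent ring. -/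

import Mathlib

open Polynomial

noncomputable section

/-- Integration on `K[x]`: the `K`-linear map with `x ^ n ↦ x ^ (n + 1) / (n + 1)` for all `n`. -/
def polyIntegral (K : Type*) [Field K] : K[X] →ₗ[K] K[X] :=
  Polynomial.lsum fun n =>
    (Polynomial.monomial (n + 1)).comp (LinearMap.mulLeft K ((n : K) + 1)⁻¹)

theorem polyIntegral_monomial (K : Type*) [Field K] (n : ℕ) (c : K) :
    polyIntegral K (Polynomial.monomial n c) =
      Polynomial.monomial (n + 1) (((n : K) + 1)⁻¹ * c) := by
  simp [polyIntegral]

/-- The algebra `K⟨x, d/dx, ∫⟩` of polynomial integro-differential operators, as a subalgebra of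
`End_K(K[x])`; the generator `x` is multiplication by `x`. -/
def IntegroDiff (K : Type*) [Field K] : Subalgebra K (Module.End K K[X]) :=
  Algebra.adjoin K
    {LinearMap.mulLeft K (Polynomial.X : K[X]), Polynomial.derivative, polyIntegral K}

end

/-- A left module is coherent if it is finitely generated and each of its finitely generated
submodules is finitely presented. -/
def IsCoherentModule (R : Type*) [Ring R] (M : Type*) [AddCommGroup M] [Module R M] : Prop :=
  Module.Finite R M ∧ ∀ N : Submodule R M, N.FG → Module.FinitePresentation R N

/-- A ring is left coherent if it is coherent as a left module over itself. -/
def IsLeftCoherentRing (R : Type*) [Ring R] : Prop :=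
  IsCoherentModule R R

/-- A ring is right coherent if it is coherent as a right module over itself; right modules are
left modules over the opposite ring. -/
def IsRightCoherentRing (R : Type*) [Ring R] : Prop :=
  IsCoherentModule Rᵐᵒᵖ R

/-! Write `d` for the derivation, `s` for integration, `h = d x` and `e = 1 - s d`, the evaluation
at zero. The relations among these four are invariant under reversing products and exchanging `d`
with `s`, so right coherence is left coherence of the opposite algebra.

Since `d s = 1` and `d p(h) = p(h + 1) d`, a power of `d` turns any element into a skew polynomial
in `d` over `K[h]`. These skew polynomials have finitely generated left ideals and satisfy the left
Ore condition. What multiplying by `d` forgets is recovered from `1 = s d + e`: an element `a` is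
determined by `d a` and `e a`, and `e A = e K[d]` has basis `e dʲ` (`f ↦ f⁽ʲ⁾(0)`), on which `h`
acts from the right by the scalar `j + 1`.

This gives a dichotomy for a left ideal `I`. If `I` contains the value of a nonzero skew polynomial
`P`, then `e A` is finite-dimensional modulo `e A P`, because the leading coefficient of `P`
vanishes at only finitely many `j + 1`; hence `I` is finitely generated (`fg_of_skewEval_mem`).
Otherwise every element of `I` is killed by a power of `d`, and `I` is finitely generated as soon as
`e I` is finite-dimensional (`fg_of_forall_skewEval_notMem`). Annihilators of elements and
intersections of two finitely generated left ideals are settled by this dichotomy, and coherence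
follows. -/

/-! ### Skew polynomials over a commutative ring -/

/-- For an endomorphism `σ` of `R`, the left multiplication by the variable `Y` in the skew
polynomial ring with `Y * a = σ a * Y`, on elements written with coefficients on the left. -/
noncomputable def skewShift {R : Type*} [CommRing R] (σ : R →+* R) : R[X] →+ R[X] :=
  (AddMonoidHom.mulLeft X).comp (mapRingHom σ).toAddMonoidHom

theorem skewShift_apply {R : Type*} [CommRing R] (σ : R →+* R) (P : R[X]) :
    skewShift σ P = X * P.map σ := rfl

theorem skewShift_monomial {R : Type*} [CommRing R] (σ : R →+* R) (n : ℕ) (a : R) :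
    skewShift σ (monomial n a) = monomial (n + 1) (σ a) := by
  rw [skewShift_apply, map_monomial, X_mul_monomial]

theorem coeff_skewShift_iterate {R : Type*} [CommRing R] (σ : R →+* R) (P : R[X]) (i n : ℕ) :
    ((skewShift σ)^[i] P).coeff (n + i) = σ^[i] (P.coeff n) := by
  induction i with
  | zero => rfl
  | succ i ih =>
    rw [Function.iterate_succ_apply', Function.iterate_succ_apply', ← ih, skewShift_apply,
      ← add_assoc, coeff_X_mul, coeff_map]

theorem degree_skewShift_iterate_lt {R : Type*} [CommRing R] (σ : R →+* R) (P : R[X]) (i m : ℕ)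
    (h : P.degree < m) : ((skewShift σ)^[i] P).degree < (m + i : ℕ) := by
  induction i with
  | zero => exact h
  | succ i ih =>
    rw [Function.iterate_succ_apply', skewShift_apply, degree_lt_iff_coeff_zero]
    rw [degree_lt_iff_coeff_zero] at ih
    intro n hn
    obtain ⟨k, rfl⟩ : ∃ k, n = k + 1 := ⟨n - 1, by omega⟩
    rw [coeff_X_mul, coeff_map, ih k (by omega), map_zero]

/-- The product `A * P` in the skew polynomial ring, as a linear function of `A`. -/
noncomputable def skewMul {R : Type*} [CommRing R] (σ : R →+* R) (P : R[X]) : R[X] →ₗ[R] R[X] :=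
  lsum fun i => LinearMap.toSpanSingleton R R[X] ((skewShift σ)^[i] P)

theorem skewMul_monomial {R : Type*} [CommRing R] (σ : R →+* R) (P : R[X]) (n : ℕ) (a : R) :
    skewMul σ P (monomial n a) = C a * (skewShift σ)^[n] P := by
  simp [skewMul, smul_eq_C_mul]

theorem skewMul_eq_sum_range {R : Type*} [CommRing R] (σ : R →+* R) (P A : R[X]) (n : ℕ)
    (h : A.degree < n) :
    skewMul σ P A = ∑ i ∈ Finset.range n, C (A.coeff i) * (skewShift σ)^[i] P := by
  by_cases hA : A = 0
  · simp [hA]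
  rw [skewMul, lsum_apply, sum_over_range' (n := n)]
  · simp [smul_eq_C_mul]
  · simp
  · exact (natDegree_lt_iff_degree_lt hA).2 h

theorem degree_skewMul_lt {R : Type*} [CommRing R] (σ : R →+* R) (P A : R[X]) (n m : ℕ)
    (hA : A.degree < (n + 1 : ℕ)) (hP : P.degree < m) :
    (skewMul σ P A).degree < (n + m : ℕ) := by
  rw [skewMul_eq_sum_range σ P A _ hA, ← mem_degreeLT]
  refine Submodule.sum_mem _ fun i hi => ?_
  rw [← smul_eq_C_mul]
  refine Submodule.smul_mem _ _ (degreeLT_mono ?_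
    (mem_degreeLT.2 (degree_skewShift_iterate_lt σ P i m hP)))
  have := Finset.mem_range.1 hi
  omega

/-- The top coefficient of the product is `a * σⁿ p`, with `a`, `p` the leading coefficients and `n`
the degree of `A`; it is nonzero because `R` is a domain and `σ` is injective. -/
theorem skewMul_ne_zero {R : Type*} [CommRing R] [IsDomain R] {σ : R →+* R}
    (hσ : Function.Injective σ) {P A : R[X]} (hA : A ≠ 0) (hP : P ≠ 0) : skewMul σ P A ≠ 0 := by
  intro h0
  have h := congrArg (fun Q => coeff Q (P.natDegree + A.natDegree)) h0
  simp only [coeff_zero] at h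
  rw [skewMul_eq_sum_range σ P A _ (degree_le_natDegree.trans_lt
    (WithBot.coe_lt_coe.2 (Nat.lt_succ_self A.natDegree))), finsetSum_coeff,
    Finset.sum_range_succ, Finset.sum_eq_zero, zero_add, coeff_C_mul, coeff_skewShift_iterate] at h
  · rcases mul_eq_zero.1 h with h | h
    · exact hA (leadingCoeff_eq_zero.1 h)
    · refine hP (leadingCoeff_eq_zero.1 (hσ.iterate A.natDegree ?_))
      exact h.trans (iterate_map_zero σ _).symm
  · intro i hi
    rw [coeff_C_mul]
    have h1 := degree_skewShift_iterate_lt σ P i _ (degree_le_natDegree.trans_lt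
      (WithBot.coe_lt_coe.2 (Nat.lt_succ_self P.natDegree)))
    rw [degree_lt_iff_coeff_zero] at h1
    have := Finset.mem_range.1 hi
    rw [h1 _ (by omega), mul_zero]

/-- Skew polynomials over a commutative domain satisfy the left Ore condition. -/
theorem exists_skewMul_eq_skewMul {R : Type*} [CommRing R] [IsDomain R] {σ : R →+* R}
    (hσ : Function.Injective σ) {P Q : R[X]} (hP : P ≠ 0) (hQ : Q ≠ 0) :
    ∃ A B, skewMul σ P A = skewMul σ Q B ∧ skewMul σ P A ≠ 0 := by
  let p := P.natDegree
  let q := Q.natDegree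
  have hdP : P.degree < (p + 1 : ℕ) := degree_le_natDegree.trans_lt
    (WithBot.coe_lt_coe.2 (Nat.lt_succ_self p))
  have hdQ : Q.degree < (q + 1 : ℕ) := degree_le_natDegree.trans_lt
    (WithBot.coe_lt_coe.2 (Nat.lt_succ_self q))
  let f : degreeLT R (q + 1) × degreeLT R (p + 1) →ₗ[R] R[X] :=
    ((skewMul σ P).comp (degreeLT R (q + 1)).subtype).coprod
      (-(skewMul σ Q).comp (degreeLT R (p + 1)).subtype)
  have hf : ∀ x, f x ∈ degreeLT R (p + q + 1) := by
    rintro ⟨⟨A, hA⟩, ⟨B, hB⟩⟩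
    have h1 := degree_skewMul_lt σ P A q (p + 1) (mem_degreeLT.1 hA) hdP
    have h2 := degree_skewMul_lt σ Q B p (q + 1) (mem_degreeLT.1 hB) hdQ
    have h1' : skewMul σ P A ∈ degreeLT R (p + q + 1) :=
      mem_degreeLT.2 (by rwa [show p + q + 1 = q + (p + 1) by ring])
    have h2' : skewMul σ Q B ∈ degreeLT R (p + q + 1) := mem_degreeLT.2 h2
    simpa [f] using add_mem h1' (neg_mem h2')
  -- Rank count: the source is free of rank `(q + 1) + (p + 1)`, the target of rank `p + q + 1`.
  have hni : ¬ Function.Injective (f.codRestrict _ hf) := by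
    intro hinj
    let E := ((degreeLTEquiv R (q + 1)).symm.prodCongr (degreeLTEquiv R (p + 1)).symm)
    have h3 := LinearMap.finrank_le_finrank_of_injective
      (f := ((degreeLTEquiv R (p + q + 1)).toLinearMap.comp (f.codRestrict _ hf)).comp
        E.toLinearMap)
      ((degreeLTEquiv R (p + q + 1)).injective.comp (hinj.comp E.injective))
    simp at h3
    omega
  have hker : LinearMap.ker (f.codRestrict _ hf) ≠ ⊥ := fun h => hni (LinearMap.ker_eq_bot.1 h)
  obtain ⟨⟨⟨A, hA⟩, ⟨B, hB⟩⟩, hx, hx0⟩ := Submodule.exists_mem_ne_zero_of_ne_bot hker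
  rw [LinearMap.ker_codRestrict, LinearMap.mem_ker] at hx
  have hAB : skewMul σ P A = skewMul σ Q B := by
    have : skewMul σ P A - skewMul σ Q B = 0 := by simpa [f, sub_eq_add_neg] using hx
    exact sub_eq_zero.1 this
  refine ⟨A, B, hAB, fun h0 => hx0 ?_⟩
  have hA0 : A = 0 := by
    by_contra h
    exact skewMul_ne_zero hσ h hP h0
  have hB0 : B = 0 := by
    by_contra h
    exact skewMul_ne_zero hσ h hQ (hAB ▸ h0)
  subst hA0 hB0
  rfl

/-- Left ideals of the skew polynomial ring over `K[X]` are finitely generated, if the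
twist preserves degrees. -/
theorem exists_finite_skewShift_generators {K : Type*} [Field K] {σ : K[X] →+* K[X]}
    (hσ : ∀ p, (σ p).degree = p.degree) (M : Submodule K[X] K[X][X])
    (hM : ∀ P ∈ M, skewShift σ P ∈ M) :
    ∃ T : Set K[X][X], T.Finite ∧ T ⊆ M ∧ ∀ N : Submodule K[X] K[X][X],
      (∀ P ∈ N, skewShift σ P ∈ N) → T ⊆ N → M ≤ N := by
  by_cases h0 : M = ⊥
  · exact ⟨∅, Set.finite_empty, Set.empty_subset _, fun N _ _ => h0 ▸ bot_le⟩
  obtain ⟨g₀, hg₀⟩ := Submodule.exists_mem_ne_zero_of_ne_bot h0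
  -- `g` has a leading coefficient of least degree among all nonzero elements of `M`, whatever their
  -- degree in the skew variable. Its shifts reduce everything of degree at least that of `g`; what
  -- lies below is a submodule of a finite free `K[X]`-module.
  obtain ⟨g, ⟨hgM, hg0⟩, hmin⟩ := WellFounded.has_min
    (measure fun Q : K[X][X] => Q.leadingCoeff.natDegree).wf {Q | Q ∈ M ∧ Q ≠ 0} ⟨g₀, hg₀⟩
  have hσi : ∀ i p, (σ^[i] p).degree = p.degree := by
    intro i p
    induction i with
    | zero => rfl
    | succ i ih => rw [Function.iterate_succ_apply', hσ, ih]
  have : IsNoetherian K[X] (degreeLT K[X] g.natDegree) :=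
    isNoetherian_of_linearEquiv (degreeLTEquiv K[X] g.natDegree).symm
  have hfg : (M ⊓ degreeLT K[X] g.natDegree).FG := by
    have h := IsNoetherian.noetherian (M.comap (degreeLT K[X] g.natDegree).subtype)
    have h2 := h.map (degreeLT K[X] g.natDegree).subtype
    rwa [Submodule.map_comap_subtype, inf_comm] at h2
  obtain ⟨S, hS⟩ := hfg
  refine ⟨insert g S, S.finite_toSet.insert g, ?_, ?_⟩
  · refine Set.insert_subset hgM fun x hx => ?_
    have : x ∈ M ⊓ degreeLT K[X] g.natDegree := hS ▸ Submodule.subset_span hx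
    exact this.1
  intro N hN hTN
  have hgN : ∀ i, (skewShift σ)^[i] g ∈ N := fun i => by
    induction i with
    | zero => exact hTN (Set.mem_insert _ _)
    | succ i ih => rw [Function.iterate_succ_apply']; exact hN _ ih
  have hgM' : ∀ i, (skewShift σ)^[i] g ∈ M := fun i => by
    induction i with
    | zero => exact hgM
    | succ i ih => rw [Function.iterate_succ_apply']; exact hM _ ih
  have hlow : M ⊓ degreeLT K[X] g.natDegree ≤ N := by
    rw [← hS, Submodule.span_le]
    exact (Set.subset_insert _ _).trans hTN
  have key : ∀ n : ℕ, ∀ P ∈ M, P.degree < (g.natDegree + n : ℕ) → P ∈ N := by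
    intro n
    induction n with
    | zero => exact fun P hP hd => hlow ⟨hP, mem_degreeLT.2 hd⟩
    | succ n ih =>
      intro P hP hd
      set G := (skewShift σ)^[n] g with hG
      set m := g.natDegree + n with hm
      have hGc : G.coeff m = σ^[n] g.leadingCoeff := coeff_skewShift_iterate σ g n _
      have hGd : G.degree < (m + 1 : ℕ) := by
        have := degree_skewShift_iterate_lt σ g n _ (degree_le_natDegree.trans_lt
          (WithBot.coe_lt_coe.2 (Nat.lt_succ_self g.natDegree)))
        rwa [show m + 1 = g.natDegree.succ + n by omega]
      have hGc0 : G.coeff m ≠ 0 := by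
        rw [hGc, ← degree_ne_bot, hσi, degree_ne_bot]
        exact leadingCoeff_ne_zero.2 hg0
      -- Euclidean division of the top coefficient by that of `G`. As `σ` preserves degrees, a
      -- nonzero remainder would be a leading coefficient of smaller degree than that of `g`, so the
      -- remainder is zero.
      let P' := P - C (P.coeff m / G.coeff m) * G
      have hP'M : P' ∈ M := by
        refine sub_mem hP ?_
        rw [← smul_eq_C_mul]
        exact M.smul_mem _ (hgM' n)
      have hc : P'.coeff m = P.coeff m % G.coeff m := by
        rw [EuclideanDomain.mod_eq_sub_mul_div]
        simp [P', mul_comm]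
      have hd' : P'.degree < (m + 1 : ℕ) := by
        rw [← mem_degreeLT] at hd hGd ⊢
        refine sub_mem hd ?_
        rw [← smul_eq_C_mul]
        exact Submodule.smul_mem _ _ hGd
      have hc0 : P'.coeff m = 0 := by
        by_contra hne
        have hP'0 : P' ≠ 0 := fun h => hne (by rw [h, coeff_zero])
        have hnat : P'.natDegree = m :=
          le_antisymm (Nat.lt_succ_iff.1 ((natDegree_lt_iff_degree_lt hP'0).2 hd'))
            (le_natDegree_of_ne_zero hne)
        refine hmin P' ⟨hP'M, hP'0⟩ ?_
        change P'.leadingCoeff.natDegree < g.leadingCoeff.natDegree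
        rw [leadingCoeff, hnat]
        refine natDegree_lt_natDegree hne ?_
        rw [← hσi n g.leadingCoeff, ← hGc, hc]
        exact EuclideanDomain.mod_lt _ hGc0
      have hP'N : P' ∈ N := by
        refine ih P' hP'M ?_
        rw [degree_lt_iff_coeff_zero] at hd' ⊢
        intro j hj
        rcases hj.eq_or_lt with rfl | hj
        · exact hc0
        · exact hd' j hj
      have : P = P' + (P.coeff m / G.coeff m) • G := by simp [P', smul_eq_C_mul]
      rw [this]
      exact add_mem hP'N (N.smul_mem _ (hgN n))
  intro P hP
  refine key (P.natDegree + 1) P hP (mem_degreeLT.1 (degreeLT_mono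
    (Nat.le_add_left _ g.natDegree) (mem_degreeLT.2 (degree_le_natDegree.trans_lt
      (WithBot.coe_lt_coe.2 (Nat.lt_succ_self _))))))

/-! ### Criterion for coherence -/

/-- A ring is left coherent if annihilators of elements and intersections of two finitely
generated left ideals are finitely generated. -/
theorem isLeftCoherentRing_of_fg_ker_of_fg_inf {A : Type*} [Ring A]
    (hker : ∀ a : A, (LinearMap.ker (LinearMap.toSpanSingleton A A a)).FG)
    (hinf : ∀ I J : Submodule A A, I.FG → J.FG → (I ⊓ J).FG) : IsLeftCoherentRing A := by
  refine ⟨inferInstance, fun N hN => ?_⟩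
  induction N, hN using Submodule.fg_induction with
  | singleton x =>
    rw [← LinearMap.range_toSpanSingleton]
    refine Module.finitePresentation_of_surjective
      (LinearMap.toSpanSingleton A A x).rangeRestrict
      (LinearMap.surjective_rangeRestrict _) ?_
    rw [LinearMap.ker_rangeRestrict]
    exact hker x
  | sup I J hI hJ hI' hJ' =>
    let f : I × J →ₗ[A] A := I.subtype.coprod J.subtype
    have hf : LinearMap.range f = I ⊔ J := by
      simp [f, LinearMap.range_coprod]
    rw [← hf]
    refine Module.finitePresentation_of_surjective f.rangeRestrict
      (LinearMap.surjective_rangeRestrict _) ?_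
    rw [LinearMap.ker_rangeRestrict]
    -- The antidiagonal embedding `z ↦ (z, -z)`, whose image is the kernel of the addition map `I ×
    -- J → I + J`.
    let g : (I ⊓ J : Submodule A A) →ₗ[A] I × J :=
      (Submodule.inclusion inf_le_left).prod (-Submodule.inclusion inf_le_right)
    have hg : LinearMap.ker f = LinearMap.range g := by
      ext ⟨⟨x, hx⟩, ⟨y, hy⟩⟩
      constructor
      · intro h
        have hxy : x + y = 0 := by simpa [f] using h
        have hy' : y = -x := (neg_eq_of_add_eq_zero_right hxy).symm
        exact ⟨⟨x, hx, by simpa [hy'] using hy⟩, by ext <;> simp [g, hy']⟩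
      · rintro ⟨z, hz⟩
        have h1 : (z : A) = x := by simpa [g] using congrArg (fun w => (w.1 : A)) hz
        have h2 : -(z : A) = y := by simpa [g] using congrArg (fun w => (w.2 : A)) hz
        simp [f, ← h1, ← h2]
    rw [hg, LinearMap.range_eq_map]
    exact Submodule.FG.map _ (Submodule.fg_top _ |>.2 (hinf I J hI hJ))

theorem IsLeftCoherentRing.isRightCoherentRing {A : Type*} [Ring A]
    (h : IsLeftCoherentRing Aᵐᵒᵖ) : IsRightCoherentRing A := by
  let E : A ≃ₗ[Aᵐᵒᵖ] Aᵐᵒᵖ :=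
    { MulOpposite.opAddEquiv with map_smul' := fun r x => by simp }
  refine ⟨Module.Finite.equiv E.symm, fun N hN => ?_⟩
  have := h.2 (N.map E.toLinearMap) (hN.map _)
  exact Module.FinitePresentation.of_equiv (E.submoduleMap N).symm

/-! ### The abstract relations and the right action on functionals -/

/-- Elements `d`, `s`, `h`, `e` generating the `K`-algebra `A` and satisfying the relations of
the derivation, the integration, `f ↦ (x f)'` and the evaluation at zero. -/
structure IsIntegroDiffSystem (K : Type*) [Field K] {A : Type*} [Ring A] [Algebra K A]
    (d s h e : A) : Prop where
  d_mul_s : d * s = 1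
  s_mul_d : s * d = 1 - e
  d_mul_h : d * h = (h + 1) * d
  h_mul_s : h * s = s * (h + 1)
  e_mul_h : e * h = e
  h_mul_e : h * e = e
  e_ne_zero : e ≠ 0
  adjoin_eq_top : Algebra.adjoin K {d, s, h} = ⊤

/-- The evaluation of skew polynomials `∑ pᵢ Yⁱ`, `pᵢ ∈ K[t]`, at `t = h`, `Y = d`. -/
noncomputable def skewEval {K : Type*} [Field K] {A : Type*} [Ring A] [Algebra K A] (d h : A) :
    K[X][X] →+ A :=
  eval₂AddMonoidHom (aeval h : K[X] →ₐ[K] A).toRingHom d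

/-- The coefficients of `(∑ uⱼ e dʲ) * skewEval d h P` with respect to the `e dʲ`. -/
noncomputable def functionalMul {K : Type*} [Field K] (P : K[X][X]) : K[X] →ₗ[K] K[X] :=
  lsum fun j => LinearMap.toSpanSingleton K K[X] (X ^ j * P.map (evalRingHom ((j : K) + 1)))

theorem functionalMul_X_pow {K : Type*} [Field K] (P : K[X][X]) (j : ℕ) :
    functionalMul P (X ^ j) = X ^ j * P.map (evalRingHom ((j : K) + 1)) := by
  rw [functionalMul, ← monomial_one_right_eq_X_pow, lsum_apply, sum_monomial_index _ _ (by simp)]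
  simp [monomial_one_right_eq_X_pow]

theorem degree_functionalMul_lt {K : Type*} [Field K] (P : K[X][X]) (u : K[X]) (m n : ℕ)
    (hu : u.degree < (m + 1 : ℕ)) (hP : P.degree < (n + 1 : ℕ)) :
    (functionalMul P u).degree < (m + n + 1 : ℕ) ∧
      (functionalMul P u).coeff (m + n) = u.coeff m * (P.coeff n).eval ((m : K) + 1) := by
  have hsum : functionalMul P u = ∑ j ∈ Finset.range (m + 1),
      C (u.coeff j) * (X ^ j * P.map (evalRingHom ((j : K) + 1))) := by
    by_cases h0 : u = 0
    · simp [h0]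
    rw [functionalMul, lsum_apply, sum_over_range' (n := m + 1)]
    · simp [smul_eq_C_mul]
    · simp
    · exact (natDegree_lt_iff_degree_lt h0).2 hu
  rw [degree_lt_iff_coeff_zero] at hP
  have hc : ∀ j k, j + n < k →
      (C (u.coeff j) * (X ^ j * P.map (evalRingHom ((j : K) + 1)))).coeff k = 0 := by
    intro j k hk
    obtain ⟨i, rfl⟩ : ∃ i, k = i + j := ⟨k - j, by omega⟩
    rw [coeff_C_mul, coeff_X_pow_mul, coeff_map, hP i (by omega), map_zero, mul_zero]
  rw [hsum]
  constructor
  · rw [degree_lt_iff_coeff_zero]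
    intro k hk
    rw [finsetSum_coeff]
    refine Finset.sum_eq_zero fun j hj => hc j k ?_
    have := Finset.mem_range.1 hj
    omega
  · rw [finsetSum_coeff, Finset.sum_range_succ, Finset.sum_eq_zero, zero_add, coeff_C_mul,
      add_comm m n, coeff_X_pow_mul, coeff_map, coe_evalRingHom]
    intro j hj
    refine hc j _ ?_
    have := Finset.mem_range.1 hj
    omega

/-- In characteristic zero the `j + 1` are distinct, and `p` has finitely many roots. -/
theorem exists_forall_ge_eval_natCast_ne_zero {K : Type*} [Field K] [CharZero K] {p : K[X]}
    (hp : p ≠ 0) : ∃ N : ℕ, ∀ j ≥ N, p.eval ((j : K) + 1) ≠ 0 := by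
  have hfin : {j : ℕ | p.eval ((j : K) + 1) = 0}.Finite := by
    have hinj : Function.Injective fun j : ℕ => (j : K) + 1 := fun a b hab => by simpa using hab
    classical
    refine ((p.roots.toFinset.finite_toSet).preimage hinj.injOn).subset fun j hj => ?_
    simpa [hp] using hj
  obtain ⟨b, hb⟩ := hfin.bddAbove
  exact ⟨b + 1, fun j hj h0 => absurd (hb h0) (by omega)⟩

/-- Every functional is, modulo the multiples of `P`, of bounded order. -/
theorem exists_eq_add_functionalMul {K : Type*} [Field K] [CharZero K] {P : K[X][X]}
    (hP : P ≠ 0) : ∃ N : ℕ, ∀ u : K[X], ∃ u' w : K[X],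
      u'.degree < N ∧ u = u' + functionalMul P w := by
  obtain ⟨j₀, hj₀⟩ := exists_forall_ge_eval_natCast_ne_zero (leadingCoeff_ne_zero.2 hP)
  have hPd : P.degree < (P.natDegree + 1 : ℕ) := degree_le_natDegree.trans_lt
    (WithBot.coe_lt_coe.2 (Nat.lt_succ_self _))
  -- A term of degree `m + P.natDegree` can be cancelled by a multiple of `P` once `m ≥ j₀`, since
  -- the leading coefficient of `P` does not vanish at `m + 1`.
  refine ⟨j₀ + P.natDegree, ?_⟩
  have key : ∀ n : ℕ, ∀ u : K[X], u.degree < (j₀ + P.natDegree + n : ℕ) → ∃ u' w : K[X],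
      u'.degree < (j₀ + P.natDegree : ℕ) ∧ u = u' + functionalMul P w := by
    intro n
    induction n with
    | zero => exact fun u hu => ⟨u, 0, hu, by simp⟩
    | succ n ih =>
      intro u hu
      set m := j₀ + n with hm
      set c := (P.coeff P.natDegree).eval ((m : K) + 1) with hc
      have hc0 : c ≠ 0 := hj₀ m (by omega)
      let w : K[X] := monomial m (u.coeff (m + P.natDegree) / c)
      obtain ⟨h1, h2⟩ := degree_functionalMul_lt P w m P.natDegree
        ((degree_monomial_le _ _).trans_lt (WithBot.coe_lt_coe.2 (Nat.lt_succ_self _))) hPd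
      rw [coeff_monomial_same, ← hc, div_mul_cancel₀ _ hc0] at h2
      obtain ⟨u', w', hu', he⟩ := ih (u - functionalMul P w) (by
        rw [degree_lt_iff_coeff_zero] at h1 hu ⊢
        intro k hk
        rw [coeff_sub]
        rcases eq_or_ne k (m + P.natDegree) with rfl | hk'
        · rw [h2, sub_self]
        · rw [h1 k (by omega), hu k (by omega), sub_zero])
      refine ⟨u', w' + w, hu', ?_⟩
      rw [map_add, ← add_assoc, ← he, sub_add_cancel]
  intro u
  refine key (u.natDegree + 1) u (mem_degreeLT.1 (degreeLT_mono (Nat.le_add_left _ _)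
    (mem_degreeLT.2 (degree_le_natDegree.trans_lt (WithBot.coe_lt_coe.2 (Nat.lt_succ_self _))))))

/-- The top coefficient of the product is that of `u` times the leading coefficient of `P` at
`u.natDegree + 1`, and the second factor is nonzero for large degrees. -/
theorem exists_functionalMul_injOn {K : Type*} [Field K] [CharZero K] {P : K[X][X]}
    (hP : P ≠ 0) : ∃ N : ℕ, ∀ u : K[X], N ≤ u.natDegree → functionalMul P u = 0 → u = 0 := by
  obtain ⟨j₀, hj₀⟩ := exists_forall_ge_eval_natCast_ne_zero (leadingCoeff_ne_zero.2 hP)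
  refine ⟨j₀, fun u hu h0 => ?_⟩
  have h := (degree_functionalMul_lt P u u.natDegree P.natDegree
    (degree_le_natDegree.trans_lt (WithBot.coe_lt_coe.2 (Nat.lt_succ_self _)))
    (degree_le_natDegree.trans_lt (WithBot.coe_lt_coe.2 (Nat.lt_succ_self _)))).2
  rw [h0, coeff_zero, eq_comm, mul_eq_zero] at h
  exact leadingCoeff_eq_zero.1 (h.resolve_right (hj₀ _ hu))

/-! ### Calculus with the relations -/

section
variable {K : Type*} [Field K] {A : Type*} [Ring A] [Algebra K A] {d s h e : A}

theorem skewEval_monomial (d h : A) (n : ℕ) (p : K[X]) :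
    skewEval d h (monomial n p) = aeval h p * d ^ n :=
  eval₂_monomial _ _

theorem skewEval_C_mul (d h : A) (p : K[X]) (P : K[X][X]) :
    skewEval d h (C p * P) = aeval h p * skewEval d h P := by
  induction P using Polynomial.induction_on' with
  | add P Q hP hQ => rw [mul_add, map_add, map_add, hP, hQ, mul_add]
  | monomial n q => rw [C_mul_monomial, skewEval_monomial, skewEval_monomial, map_mul, mul_assoc]

namespace IsIntegroDiffSystem

/-- Reversing products exchanges the roles of `d` and `s` and fixes `h` and `e`. This symmetry is
the reason for using `h` as a generator in place of `x`. -/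
theorem op (H : IsIntegroDiffSystem K d s h e) : IsIntegroDiffSystem K
    (MulOpposite.op s) (MulOpposite.op d) (MulOpposite.op h) (MulOpposite.op e) where
  d_mul_s := congrArg MulOpposite.op H.d_mul_s
  s_mul_d := congrArg MulOpposite.op H.s_mul_d
  d_mul_h := congrArg MulOpposite.op H.h_mul_s
  h_mul_s := congrArg MulOpposite.op H.d_mul_h
  e_mul_h := congrArg MulOpposite.op H.h_mul_e
  h_mul_e := congrArg MulOpposite.op H.e_mul_h
  e_ne_zero := fun h0 => H.e_ne_zero (MulOpposite.op_injective h0)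
  adjoin_eq_top := by
    have h1 := Subalgebra.op_adjoin (R := K) ({d, s, h} : Set A)
    rw [H.adjoin_eq_top, Subalgebra.op_top] at h1
    rw [h1]
    congr 1
    ext x
    simp only [Set.mem_insert_iff, Set.mem_singleton_iff, Set.mem_preimage,
      ← MulOpposite.unop_inj, MulOpposite.unop_op]
    tauto

theorem e_mul_s (H : IsIntegroDiffSystem K d s h e) : e * s = 0 := by
  have h1 : (1 - e) * s = s := by rw [← H.s_mul_d, mul_assoc, H.d_mul_s, mul_one]
  rw [sub_mul, one_mul] at h1
  exact sub_eq_self.1 h1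

theorem induction_on (H : IsIntegroDiffSystem K d s h e) {p : A → Prop} (hd : p d) (hs : p s)
    (hh : p h) (algebraMap : ∀ c : K, p (algebraMap K A c)) (add : ∀ x y, p x → p y → p (x + y))
    (mul : ∀ x y, p x → p y → p (x * y)) (a : A) : p a := by
  have ha : a ∈ Algebra.adjoin K {d, s, h} := H.adjoin_eq_top ▸ Algebra.mem_top
  induction ha using Algebra.adjoin_induction with
  | mem x hx => rcases hx with rfl | rfl | rfl <;> assumption
  | algebraMap c => exact algebraMap c
  | add x y _ _ hx hy => exact add x y hx hy
  | mul x y _ _ hx hy => exact mul x y hx hy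

theorem d_mul_aeval (H : IsIntegroDiffSystem K d s h e) (p : K[X]) :
    d * aeval h p = aeval h (taylor 1 p) * d := by
  induction p using Polynomial.induction_on with
  | C a => rw [taylor_C, aeval_C, Algebra.commutes]
  | add p q hp hq => rw [map_add, map_add, map_add, mul_add, add_mul, hp, hq]
  | monomial n a ih =>
    rw [pow_succ, ← mul_assoc]
    generalize C a * X ^ n = q at ih ⊢
    rw [map_mul, ← mul_assoc, ih, taylor_mul, map_mul, mul_assoc, aeval_X, H.d_mul_h, taylor_X, map_add, aeval_X, map_one, map_one, mul_assoc]

theorem d_mul_skewEval (H : IsIntegroDiffSystem K d s h e) (P : K[X][X]) :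
    d * skewEval d h P = skewEval d h (skewShift (taylorAlgHom (1 : K)).toRingHom P) := by
  induction P using Polynomial.induction_on' with
  | add P Q hP hQ => rw [map_add, map_add, map_add, mul_add, hP, hQ]
  | monomial n q =>
    rw [skewShift_monomial, skewEval_monomial, skewEval_monomial, ← mul_assoc, H.d_mul_aeval,
      pow_succ', mul_assoc]
    rfl

theorem d_pow_mul_skewEval (H : IsIntegroDiffSystem K d s h e) (n : ℕ) (P : K[X][X]) :
    d ^ n * skewEval d h P =
      skewEval d h ((skewShift (taylorAlgHom (1 : K)).toRingHom)^[n] P) := by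
  induction n with
  | zero => simp
  | succ n ih =>
    rw [pow_succ', mul_assoc, ih, H.d_mul_skewEval, Function.iterate_succ_apply']

theorem skewEval_skewMul (H : IsIntegroDiffSystem K d s h e) (P Q : K[X][X]) :
    skewEval d h (skewMul (taylorAlgHom (1 : K)).toRingHom P Q) =
      skewEval d h Q * skewEval d h P := by
  induction Q using Polynomial.induction_on' with
  | add Q R hQ hR => rw [map_add, map_add, map_add, add_mul, hQ, hR]
  | monomial n q =>
    rw [skewMul_monomial, skewEval_C_mul, ← H.d_pow_mul_skewEval, skewEval_monomial, mul_assoc]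

/-- Moving `dⁿ` to the right only shifts the coefficients in `h` by `n`. In a product this lets a
power of `d` pass the first factor and clear the second. -/
theorem d_pow_mul_eq_skewEval_mul (H : IsIntegroDiffSystem K d s h e) (P : K[X][X]) (n : ℕ) :
    ∃ Q : K[X][X], d ^ n * skewEval d h P = skewEval d h Q * d ^ n := by
  induction P using Polynomial.induction_on' with
  | add P Q hP hQ =>
    obtain ⟨P', hP⟩ := hP
    obtain ⟨Q', hQ⟩ := hQ
    exact ⟨P' + Q', by rw [map_add, map_add, mul_add, add_mul, hP, hQ]⟩
  | monomial i p =>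
    have key : ∃ q : K[X], d ^ n * aeval h p = aeval h q * d ^ n := by
      induction n with
      | zero => exact ⟨p, by simp⟩
      | succ n ih =>
        obtain ⟨q, hq⟩ := ih
        exact ⟨taylor 1 q, by
          rw [pow_succ', mul_assoc, hq, ← mul_assoc, H.d_mul_aeval, mul_assoc]⟩
    obtain ⟨q, hq⟩ := key
    refine ⟨monomial i q, ?_⟩
    rw [skewEval_monomial, skewEval_monomial, ← mul_assoc, hq, mul_assoc, mul_assoc, ← pow_add,
      ← pow_add, add_comm]

/-- Every element becomes a skew polynomial in `d` after multiplication by a power of `d`. -/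
theorem exists_d_pow_mul_eq_skewEval (H : IsIntegroDiffSystem K d s h e) (a : A) :
    ∃ (n : ℕ) (P : K[X][X]), d ^ n * a = skewEval d h P := by
  have hC : ∀ p : K[X], skewEval d h (C p) = aeval h p := fun p => by
    rw [← monomial_zero_left, skewEval_monomial, pow_zero, mul_one]
  refine H.induction_on (p := fun a => ∃ (n : ℕ) (P : K[X][X]), d ^ n * a = skewEval d h P)
    ?_ ?_ ?_ ?_ ?_ ?_ a
  · exact ⟨0, monomial 1 1, by rw [skewEval_monomial]; simp⟩
  · exact ⟨1, C 1, by rw [hC, pow_one, H.d_mul_s, map_one]⟩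
  · exact ⟨0, C X, by rw [hC, aeval_X, pow_zero, one_mul]⟩
  · exact fun c => ⟨0, C (C c), by rw [hC, aeval_C, pow_zero, one_mul]⟩
  · rintro x y ⟨n, P, hP⟩ ⟨m, Q, hQ⟩
    refine ⟨n + m, (skewShift (taylorAlgHom (1 : K)).toRingHom)^[m] P +
      (skewShift (taylorAlgHom (1 : K)).toRingHom)^[n] Q, ?_⟩
    rw [map_add, ← H.d_pow_mul_skewEval, ← H.d_pow_mul_skewEval, ← hP, ← hQ, ← mul_assoc,
      ← mul_assoc, ← pow_add, ← pow_add, mul_add, add_comm m n]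
  · rintro x y ⟨n, P, hP⟩ ⟨m, Q, hQ⟩
    obtain ⟨P', hP'⟩ := H.d_pow_mul_eq_skewEval_mul P m
    refine ⟨m + n, skewMul (taylorAlgHom (1 : K)).toRingHom Q P', ?_⟩
    rw [H.skewEval_skewMul, pow_add, mul_assoc, ← mul_assoc (d ^ n), hP, ← mul_assoc, hP',
      mul_assoc, hQ]

theorem e_mul_d_pow_mul_h (H : IsIntegroDiffSystem K d s h e) (j : ℕ) :
    e * d ^ j * h = ((j : K) + 1) • (e * d ^ j) := by
  induction j with
  | zero => simp [H.e_mul_h]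
  | succ j ih =>
    rw [pow_succ, mul_assoc, mul_assoc, H.d_mul_h, ← mul_assoc, ← mul_assoc, mul_add, ih, mul_one,
      add_mul, smul_mul_assoc, ← mul_assoc, Nat.cast_succ]
    simp only [add_smul, one_smul]

theorem e_mul_d_pow_mul_aeval (H : IsIntegroDiffSystem K d s h e) (j : ℕ) (p : K[X]) :
    e * d ^ j * aeval h p = p.eval ((j : K) + 1) • (e * d ^ j) := by
  induction p using Polynomial.induction_on with
  | C a => rw [aeval_C, eval_C, Algebra.smul_def, Algebra.commutes]
  | add p q hp hq => rw [map_add, eval_add, add_smul, mul_add, hp, hq]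
  | monomial n a ih =>
    rw [pow_succ, ← mul_assoc, map_mul, ← mul_assoc, ih, aeval_X, smul_mul_assoc,
      H.e_mul_d_pow_mul_h, smul_smul, eval_mul_X]

theorem e_mul_aeval_mul_skewEval (H : IsIntegroDiffSystem K d s h e) (u : K[X]) (P : K[X][X]) :
    e * aeval d u * skewEval d h P = e * aeval d (functionalMul P u) := by
  induction u using Polynomial.induction_on' with
  | add u v hu hv => rw [map_add, map_add, map_add, mul_add, mul_add, add_mul, hu, hv]
  | monomial j c =>
    rw [← C_mul_X_pow_eq_monomial, ← smul_eq_C_mul, map_smul, map_smul, map_smul, mul_smul_comm,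
      mul_smul_comm, smul_mul_assoc, functionalMul_X_pow]
    congr 1
    induction P using Polynomial.induction_on' with
    | add P Q hP hQ => rw [map_add, mul_add, hP, hQ, Polynomial.map_add, mul_add, map_add, mul_add]
    | monomial n p =>
      rw [skewEval_monomial, map_pow, aeval_X, ← mul_assoc, H.e_mul_d_pow_mul_aeval, map_monomial,
        map_mul, map_pow, aeval_X, aeval_monomial, coe_evalRingHom, smul_mul_assoc, ← mul_assoc,
        ← mul_assoc, ← Algebra.commutes, Algebra.smul_def, mul_assoc, mul_assoc, mul_assoc]

/-- From `d s = 1` and `e s = 0`: on functionals, right multiplication by `s` lowers the order by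
one and drops the constant term. -/
theorem e_mul_aeval_mul_s (H : IsIntegroDiffSystem K d s h e) (u : K[X]) :
    e * aeval d u * s = e * aeval d u.divX := by
  conv_lhs => rw [← divX_mul_X_add u]
  rw [map_add, map_mul, aeval_X, aeval_C, mul_add, add_mul, mul_assoc, mul_assoc, H.d_mul_s,
    mul_one, mul_assoc, Algebra.commutes, ← mul_assoc, H.e_mul_s, zero_mul, add_zero]

/-- The `e dʲ` are linearly independent: right multiplication by `s` lowers the degree until only a
scalar multiple of `e` is left. -/
theorem eq_zero_of_e_mul_aeval_eq_zero (H : IsIntegroDiffSystem K d s h e) (u : K[X])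
    (hu : e * aeval d u = 0) : u = 0 := by
  obtain ⟨n, hn⟩ : ∃ n, u.natDegree ≤ n := ⟨_, le_rfl⟩
  have hconst : ∀ c : K, e * aeval d (C c) = 0 → c = 0 := fun c hc => by
    rw [aeval_C, ← Algebra.commutes, ← Algebra.smul_def] at hc
    exact (smul_eq_zero.1 hc).resolve_right H.e_ne_zero
  induction n generalizing u with
  | zero =>
    rw [eq_C_of_natDegree_le_zero hn] at hu ⊢
    rw [hconst _ hu, C_0]
  | succ n ih =>
    have h0 : u.divX = 0 := ih _ (by rw [← H.e_mul_aeval_mul_s, hu, zero_mul])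
      (by rw [natDegree_divX_eq_natDegree_tsub_one]; omega)
    have hu' := divX_mul_X_add u
    rw [h0, zero_mul, zero_add] at hu'
    rw [← hu'] at hu ⊢
    rw [hconst _ hu, C_0]

theorem exists_e_mul_eq (H : IsIntegroDiffSystem K d s h e) (a : A) :
    ∃ u : K[X], e * a = e * aeval d u := by
  -- Stability of `e K[d]` under right multiplication passes to products, unlike the claim for `e`
  -- alone.
  suffices ∀ u : K[X], ∃ v : K[X], e * aeval d u * a = e * aeval d v by
    simpa using this 1
  refine H.induction_on (p := fun a => ∀ u : K[X], ∃ v : K[X], e * aeval d u * a = e * aeval d v)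
    ?_ ?_ ?_ ?_ ?_ ?_ a
  · exact fun u => ⟨u * X, by rw [map_mul, aeval_X, mul_assoc]⟩
  · exact fun u => ⟨_, H.e_mul_aeval_mul_s u⟩
  · refine fun u => ⟨functionalMul (C X) u, ?_⟩
    rw [← H.e_mul_aeval_mul_skewEval, ← monomial_zero_left, skewEval_monomial, aeval_X, pow_zero,
      mul_one]
  · exact fun c u => ⟨u * C c, by rw [map_mul, aeval_C, mul_assoc]⟩
  · intro x y hx hy u
    obtain ⟨v, hv⟩ := hx u
    obtain ⟨w, hw⟩ := hy u
    exact ⟨v + w, by rw [map_add, mul_add, mul_add, hv, hw]⟩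
  · intro x y hx hy u
    obtain ⟨v, hv⟩ := hx u
    obtain ⟨w, hw⟩ := hy v
    exact ⟨w, by rw [← mul_assoc, hv, hw]⟩

end IsIntegroDiffSystem
end

/-! ### Finite generation of left ideals -/

namespace IsIntegroDiffSystem
variable {K : Type*} [Field K] {A : Type*} [Ring A] [Algebra K A] {d s h e : A}

/-- By `1 = s d + e`, membership of `dⁿ⁺¹ a` and of `e dⁿ a` in `J` gives that of `dⁿ a`, so one
descends to `a`. -/
theorem mem_of_d_pow_mul_mem (H : IsIntegroDiffSystem K d s h e) {I J : Submodule A A}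
    (hIJ : ∀ a ∈ I, e * a ∈ J) (n : ℕ) {a : A} (ha : a ∈ I) (hn : d ^ n * a ∈ J) : a ∈ J := by
  induction n with
  | zero => simpa using hn
  | succ n ih =>
    have h1 : d ^ n * a = s * (d ^ (n + 1) * a) + e * (d ^ n * a) := by
      rw [pow_succ', mul_assoc d, ← mul_assoc s, H.s_mul_d, sub_mul, one_mul, sub_add_cancel]
    refine ih ?_
    rw [h1]
    exact add_mem (J.smul_mem s hn) (hIJ _ (I.smul_mem _ ha))

/-- `I` is generated by `J` together with a finite spanning set of `U ∩ I`: in `e a = u + j` the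
part `u = e a - j` lies in `I` too. -/
theorem fg_of_d_pow_mul_mem (H : IsIntegroDiffSystem K d s h e) {I J : Submodule A A}
    (hJ : J.FG) (hJI : J ≤ I) (hd : ∀ a ∈ I, ∃ n, d ^ n * a ∈ J) {U : Submodule K A} (hU : U.FG)
    (he : ∀ a ∈ I, ∃ u ∈ U, ∃ j ∈ J, e * a = u + j) : I.FG := by
  obtain ⟨S, hS⟩ := Submodule.FG.of_le hU (inf_le_left : U ⊓ I.restrictScalars K ≤ U)
  have hSI : Submodule.span A (S : Set A) ≤ I := Submodule.span_le.2 fun x hx => by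
    have : x ∈ U ⊓ I.restrictScalars K := hS ▸ Submodule.subset_span hx
    exact this.2
  suffices I = J ⊔ Submodule.span A (S : Set A) from this ▸ hJ.sup ⟨S, rfl⟩
  refine le_antisymm (fun a ha => ?_) (sup_le hJI hSI)
  obtain ⟨n, hn⟩ := hd a ha
  refine H.mem_of_d_pow_mul_mem (fun b hb => ?_) n ha (Submodule.mem_sup_left hn)
  obtain ⟨u, hu, j, hj, hb'⟩ := he b hb
  rw [hb']
  refine add_mem (Submodule.mem_sup_right ?_) (Submodule.mem_sup_left hj)
  refine Submodule.span_le_restrictScalars K A (S : Set A) ?_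
  rw [hS]
  refine ⟨hu, ?_⟩
  rw [← add_sub_cancel_right u j, ← hb']
  exact sub_mem (I.smul_mem e hb) (hJI hj)

/-- The skew polynomials with value in `I` form a left ideal of the skew polynomial ring, which has
finitely many generators; their values generate `J`. -/
theorem exists_fg_skewEval_mem (H : IsIntegroDiffSystem K d s h e) (I : Submodule A A) :
    ∃ J : Submodule A A, J.FG ∧ J ≤ I ∧ ∀ P : K[X][X], skewEval d h P ∈ I → skewEval d h P ∈ J := by
  let L : Submodule A A → Submodule K[X] K[X][X] := fun J =>
    { (J.toAddSubmonoid.comap (skewEval d h)) with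
      smul_mem' := fun p P hP => by
        change skewEval d h (p • P) ∈ J
        rw [smul_eq_C_mul, skewEval_C_mul]
        exact J.smul_mem _ hP }
  have hL : ∀ J P, P ∈ L J ↔ skewEval d h P ∈ J := fun _ _ => Iff.rfl
  have hshift : ∀ J, ∀ P ∈ L J, skewShift (taylorAlgHom (1 : K)).toRingHom P ∈ L J := by
    intro J P hP
    rw [hL, ← H.d_mul_skewEval]
    exact J.smul_mem d hP
  obtain ⟨T, hT, hTI, hgen⟩ := exists_finite_skewShift_generators
    (σ := (taylorAlgHom (1 : K)).toRingHom) (fun p => degree_taylor p 1) (L I) (hshift I)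
  refine ⟨Submodule.span A (skewEval d h '' T), Submodule.fg_span (hT.image _), ?_, ?_⟩
  · rw [Submodule.span_le]
    rintro _ ⟨P, hP, rfl⟩
    exact hTI hP
  · intro P hP
    refine (hL _ P).1 (hgen (L _) (hshift _) (fun Q hQ => ?_) hP)
    exact (hL _ Q).2 (Submodule.subset_span (Set.mem_image_of_mem _ hQ))

theorem fg_map_degreeLT (d e : A) (N : ℕ) :
    ((degreeLT K N).map ((LinearMap.mulLeft K e).comp (aeval d).toLinearMap)).FG := by
  classical
  exact Submodule.FG.map _ (degreeLT_eq_span_X_pow (R := K) (n := N) ▸ ⟨_, rfl⟩)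

/-- A left ideal that contains a nonzero skew polynomial is finitely generated. -/
theorem fg_of_skewEval_mem [CharZero K] (H : IsIntegroDiffSystem K d s h e) {I : Submodule A A}
    {P : K[X][X]} (hP : P ≠ 0) (hPI : skewEval d h P ∈ I) : I.FG := by
  obtain ⟨J, hJ, hJI, hJP⟩ := H.exists_fg_skewEval_mem I
  obtain ⟨N, hN⟩ := exists_eq_add_functionalMul hP
  refine H.fg_of_d_pow_mul_mem hJ hJI (fun a ha => ?_) (fg_map_degreeLT (K := K) d e N)
    fun a ha => ?_
  · obtain ⟨n, Q, hQ⟩ := H.exists_d_pow_mul_eq_skewEval a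
    exact ⟨n, hQ ▸ hJP Q (hQ ▸ I.smul_mem _ ha)⟩
  · obtain ⟨u, hu⟩ := H.exists_e_mul_eq a
    obtain ⟨u', w, hu', huw⟩ := hN u
    refine ⟨e * aeval d u', ⟨u', mem_degreeLT.2 hu', rfl⟩, e * aeval d (functionalMul P w), ?_, ?_⟩
    · rw [← H.e_mul_aeval_mul_skewEval]
      exact J.smul_mem _ (hJP P hPI)
    · rw [hu, huw, map_add, mul_add]

/-- A left ideal without nonzero skew polynomials is finitely generated if its image under `e`
is finite-dimensional. -/
theorem fg_of_forall_skewEval_notMem (H : IsIntegroDiffSystem K d s h e) {I : Submodule A A}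
    (hI : ∀ P : K[X][X], skewEval d h P ∈ I → P = 0) {U : Submodule K A} (hU : U.FG)
    (he : ∀ a ∈ I, e * a ∈ U) : I.FG := by
  refine H.fg_of_d_pow_mul_mem Submodule.fg_bot bot_le (fun a ha => ?_) hU
    fun a ha => ⟨e * a, he a ha, 0, zero_mem _, (add_zero _).symm⟩
  obtain ⟨n, P, hP⟩ := H.exists_d_pow_mul_eq_skewEval a
  refine ⟨n, ?_⟩
  rw [hP, hI P (hP ▸ I.smul_mem _ ha), map_zero]
  exact zero_mem _

/-- If the annihilator contains no nonzero skew polynomial, then `dⁿ a` is the value of some `P ≠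
0`. Right multiplication by `P` is injective on functionals of high order, so only a
finite-dimensional space of functionals can kill `a`. -/
theorem fg_ker_toSpanSingleton [CharZero K] (H : IsIntegroDiffSystem K d s h e) (a : A) :
    (LinearMap.ker (LinearMap.toSpanSingleton A A a)).FG := by
  by_cases hex : ∃ P : K[X][X], skewEval d h P ∈ LinearMap.ker (LinearMap.toSpanSingleton A A a) ∧ P ≠ 0
  · obtain ⟨P, hP, hP0⟩ := hex
    exact H.fg_of_skewEval_mem hP0 hP
  replace hex : ∀ P : K[X][X], skewEval d h P ∈ LinearMap.ker (LinearMap.toSpanSingleton A A a) → P = 0 :=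
    fun P hP => by_contra fun hP0 => hex ⟨P, hP, hP0⟩
  obtain ⟨n, P, hP⟩ := H.exists_d_pow_mul_eq_skewEval a
  have hP0 : P ≠ 0 := by
    rintro rfl
    -- If `P = 0`, then `dⁿ` itself annihilates `a`.
    have h1 := hex (monomial n 1) (by
      simp [skewEval_monomial, hP])
    exact one_ne_zero ((monomial_eq_zero_iff _ _).1 h1)
  obtain ⟨j, hj⟩ := exists_functionalMul_injOn hP0
  let ev : K[X] →ₗ[K] A := (LinearMap.mulLeft K e).comp (aeval d).toLinearMap
  let W : Submodule K K[X] := LinearMap.ker ((LinearMap.mulRight K a).comp ev)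
  have hW : W.FG := by
    -- The first `n + j` coefficients determine `u`: if they vanish, then `u = Xʲ v Xⁿ`, where `Xⁿ`
    -- turns `a` into `P` and `Xʲ` makes the order large enough for injectivity.
    let f : W →ₗ[K] (Fin (n + j) → K) :=
      (LinearMap.pi fun i : Fin (n + j) => lcoeff K i).comp W.subtype
    refine Module.Finite.iff_fg.1 (Module.Finite.of_injective f ?_)
    refine (injective_iff_map_eq_zero f).2 fun ⟨u, hu⟩ hfu => ?_
    have hlow : ∀ i < n + j, u.coeff i = 0 := fun i hi => congrFun hfu ⟨i, hi⟩
    obtain ⟨v, rfl⟩ : X ^ (n + j) ∣ u := X_pow_dvd_iff.2 hlow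
    have hu' : e * aeval d (X ^ (n + j) * v) * a = 0 := hu
    have h2 : functionalMul P (X ^ j * v) = 0 := by
      refine H.eq_zero_of_e_mul_aeval_eq_zero _ ?_
      have hX : X ^ (n + j) * v = X ^ j * v * X ^ n := by ring
      rw [← H.e_mul_aeval_mul_skewEval, ← hP, ← hu', hX, map_mul _ _ (X ^ n), map_pow, aeval_X]
      simp only [mul_assoc]
    by_cases hv : v = 0
    · simp [hv]
    refine absurd (hj _ ?_ h2) (mul_ne_zero (pow_ne_zero _ X_ne_zero) hv)
    rw [natDegree_mul (pow_ne_zero _ X_ne_zero) hv, natDegree_X_pow]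
    exact Nat.le_add_right _ _
  refine H.fg_of_forall_skewEval_notMem hex (hW.map ev) fun r hr => ?_
  obtain ⟨u, hu⟩ := H.exists_e_mul_eq r
  refine ⟨u, ?_, hu.symm⟩
  change e * aeval d u * a = 0
  have hr' : r * a = 0 := hr
  rw [← hu, mul_assoc, hr', mul_zero]

/-- For a generator `x` killed by `dⁿ`, the space `e A x = e K[d] x` is spanned by the `e dⁱ x` with
`i < n`; finitely many generators add up. -/
theorem exists_fg_e_mul_mem (H : IsIntegroDiffSystem K d s h e) {I : Submodule A A} (hI : I.FG)
    (hd : ∀ a ∈ I, ∃ n, d ^ n * a = 0) : ∃ U : Submodule K A, U.FG ∧ ∀ a ∈ I, e * a ∈ U := by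
  suffices ∃ U : Submodule K A, U.FG ∧ ∀ a ∈ I, ∀ u : K[X], e * aeval d u * a ∈ U by
    obtain ⟨U, hU, h1⟩ := this
    exact ⟨U, hU, fun a ha => by simpa using h1 a ha 1⟩
  induction I, hI using Submodule.fg_induction with
  | singleton x =>
    obtain ⟨n, hn⟩ := hd x (Submodule.mem_span_singleton_self x)
    refine ⟨_, (fg_map_degreeLT (K := K) d e n).map (LinearMap.mulRight K x), ?_⟩
    intro a ha u
    obtain ⟨r, rfl⟩ := Submodule.mem_span_singleton.1 ha
    obtain ⟨v, hv⟩ : ∃ v : K[X], e * (aeval d u * r) = e * aeval d v := H.exists_e_mul_eq _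
    have hmod : v = v %ₘ X ^ n + v /ₘ X ^ n * X ^ n := by
      rw [mul_comm, modByMonic_add_div]
    refine ⟨e * aeval d (v %ₘ X ^ n), ⟨v %ₘ X ^ n, ?_, rfl⟩, ?_⟩
    · refine mem_degreeLT.2 ((degree_modByMonic_lt _ (monic_X_pow n)).trans_eq (degree_X_pow n))
    · change e * aeval d (v %ₘ X ^ n) * x = e * aeval d u * (r * x)
      conv_rhs => rw [mul_assoc e, ← mul_assoc (aeval d u), ← mul_assoc e, hv, hmod]
      rw [map_add, map_mul _ _ (X ^ n), map_pow, aeval_X, mul_add, add_mul, mul_assoc e _ x,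
        mul_assoc e _ x, mul_assoc _ _ x, hn, mul_zero, mul_zero, add_zero]
  | sup I J hI hJ hI' hJ' =>
    obtain ⟨U, hU, h1⟩ := hI' fun a ha => hd a (Submodule.mem_sup_left ha)
    obtain ⟨V, hV, h2⟩ := hJ' fun a ha => hd a (Submodule.mem_sup_right ha)
    refine ⟨U ⊔ V, hU.sup hV, fun a ha u => ?_⟩
    obtain ⟨x, hx, y, hy, rfl⟩ := Submodule.mem_sup.1 ha
    rw [mul_add]
    exact add_mem (Submodule.mem_sup_left (h1 x hx u)) (Submodule.mem_sup_right (h2 y hy u))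

theorem fg_inf_of_forall_skewEval_notMem (H : IsIntegroDiffSystem K d s h e) {I J : Submodule A A}
    (hI : I.FG) (hP : ∀ P : K[X][X], skewEval d h P ∈ I → P = 0) : (I ⊓ J).FG := by
  obtain ⟨U, hU, h1⟩ := H.exists_fg_e_mul_mem hI fun a ha => by
    obtain ⟨n, P, hnP⟩ := H.exists_d_pow_mul_eq_skewEval a
    refine ⟨n, ?_⟩
    rw [hnP, hP P (hnP ▸ I.smul_mem _ ha), map_zero]
  exact H.fg_of_forall_skewEval_notMem (fun P h => hP P h.1) hU fun a ha => h1 a ha.1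

theorem fg_inf [CharZero K] (H : IsIntegroDiffSystem K d s h e) {I J : Submodule A A}
    (hI : I.FG) (hJ : J.FG) : (I ⊓ J).FG := by
  by_cases hP : ∀ P : K[X][X], skewEval d h P ∈ I → P = 0
  · exact H.fg_inf_of_forall_skewEval_notMem hI hP
  by_cases hQ : ∀ Q : K[X][X], skewEval d h Q ∈ J → Q = 0
  · rw [inf_comm]
    exact H.fg_inf_of_forall_skewEval_notMem hJ hQ
  push Not at hP hQ
  obtain ⟨P, hPI, hP0⟩ := hP
  obtain ⟨Q, hQJ, hQ0⟩ := hQ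
  -- The Ore condition gives a nonzero common left multiple of `P` and `Q`, so the intersection
  -- contains the value of a nonzero skew polynomial.
  obtain ⟨B, C, hBC, h0⟩ := exists_skewMul_eq_skewMul
    (σ := (taylorAlgHom (1 : K)).toRingHom) (taylor_injective 1) hP0 hQ0
  refine H.fg_of_skewEval_mem h0 ⟨?_, ?_⟩
  · rw [H.skewEval_skewMul]
    exact I.smul_mem _ hPI
  · rw [hBC, H.skewEval_skewMul]
    exact J.smul_mem _ hQJ

theorem isLeftCoherentRing [CharZero K] (H : IsIntegroDiffSystem K d s h e) :
    IsLeftCoherentRing A :=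
  isLeftCoherentRing_of_fg_ker_of_fg_inf H.fg_ker_toSpanSingleton fun _ _ => H.fg_inf

end IsIntegroDiffSystem

/-! ### The operators on `K[X]` -/

theorem polyIntegral_derivative {K : Type*} [Field K] [CharZero K] (p : K[X]) :
    polyIntegral K (derivative p) = p - C (p.coeff 0) := by
  induction p using Polynomial.induction_on' with
  | add p q hp hq => rw [map_add, map_add, hp, hq, coeff_add, C_add]; ring
  | monomial n c =>
    rw [derivative_monomial, polyIntegral_monomial]
    cases n with
    | zero => simp
    | succ n =>
      have hn : (n : K) + 1 ≠ 0 := Nat.cast_add_one_ne_zero n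
      simp [coeff_monomial, mul_comm c, hn]

theorem derivative_polyIntegral {K : Type*} [Field K] [CharZero K] (p : K[X]) :
    derivative (polyIntegral K p) = p := by
  induction p using Polynomial.induction_on' with
  | add p q hp hq => rw [map_add, map_add, hp, hq]
  | monomial n c =>
    have hn : (n : K) + 1 ≠ 0 := Nat.cast_add_one_ne_zero n
    rw [polyIntegral_monomial, derivative_monomial]
    congr 1
    push_cast
    field_simp

namespace IntegroDiff
variable (K : Type*) [Field K]

/-- Multiplication by the variable. -/
noncomputable def x : IntegroDiff K :=
  ⟨LinearMap.mulLeft K (X : K[X]), Algebra.subset_adjoin (by simp)⟩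

/-- The derivation. -/
noncomputable def d : IntegroDiff K :=
  ⟨Polynomial.derivative, Algebra.subset_adjoin (by simp)⟩

/-- The integration. -/
noncomputable def s : IntegroDiff K :=
  ⟨polyIntegral K, Algebra.subset_adjoin (by simp)⟩

theorem mul_apply (a b : IntegroDiff K) (p : K[X]) :
    ((a * b : IntegroDiff K) : Module.End K K[X]) p = a.1 (b.1 p) := rfl

theorem add_apply (a b : IntegroDiff K) (p : K[X]) :
    ((a + b : IntegroDiff K) : Module.End K K[X]) p = a.1 p + b.1 p := rfl

theorem sub_apply (a b : IntegroDiff K) (p : K[X]) :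
    ((a - b : IntegroDiff K) : Module.End K K[X]) p = a.1 p - b.1 p := rfl

theorem one_apply (p : K[X]) : ((1 : IntegroDiff K) : Module.End K K[X]) p = p := rfl

theorem x_apply (p : K[X]) : (x K : Module.End K K[X]) p = X * p := rfl

theorem d_apply (p : K[X]) : (d K : Module.End K K[X]) p = derivative p := rfl

theorem s_apply (p : K[X]) : (s K : Module.End K K[X]) p = polyIntegral K p := rfl

theorem ext {a b : IntegroDiff K} (h : ∀ p, (a : Module.End K K[X]) p = b.1 p) : a = b :=
  Subtype.ext (LinearMap.ext h)

theorem ext_monomial {a b : IntegroDiff K}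
    (h : ∀ n c, (a : Module.End K K[X]) (monomial n c) = b.1 (monomial n c)) : a = b :=
  Subtype.ext (lhom_ext' fun n => LinearMap.ext fun c => h n c)

theorem adjoin_eq_top : Algebra.adjoin K {x K, d K, s K} = ⊤ := by
  have h := Algebra.adjoin_adjoin_coe_preimage (R := K)
    (s := ({LinearMap.mulLeft K (Polynomial.X : K[X]), Polynomial.derivative, polyIntegral K} :
      Set (Module.End K K[X])))
  refine Eq.trans ?_ h
  congr 1
  ext y
  simp only [Set.mem_insert_iff, Set.mem_singleton_iff]
  exact or_congr Subtype.ext_iff (or_congr Subtype.ext_iff Subtype.ext_iff)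

theorem d_mul_s [CharZero K] : d K * s K = 1 :=
  ext K fun p => by rw [mul_apply, d_apply, s_apply, derivative_polyIntegral, one_apply]

theorem s_mul_d_apply [CharZero K] (p : K[X]) :
    ((s K * d K : IntegroDiff K) : Module.End K K[X]) p = p - C (p.coeff 0) := by
  rw [mul_apply, d_apply, s_apply, polyIntegral_derivative]

theorem d_mul_x : d K * x K = x K * d K + 1 :=
  ext K fun p => by
    rw [mul_apply, add_apply, mul_apply, one_apply, x_apply, d_apply, x_apply, d_apply,
      derivative_mul, derivative_X, one_mul, add_comm]

theorem one_sub_s_mul_d_apply [CharZero K] (p : K[X]) :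
    ((1 - s K * d K : IntegroDiff K) : Module.End K K[X]) p = C (p.coeff 0) := by
  rw [sub_apply, one_apply, s_mul_d_apply, sub_sub_cancel]

/-- Here `h` multiplies `xⁿ` by `n + 1`, and `1 - s d` is `p ↦ p(0)`. The generator `x` is recovered
as `s h`, because `X * p` has no constant term. -/
theorem isIntegroDiffSystem [CharZero K] :
    IsIntegroDiffSystem K (d K) (s K) (d K * x K) (1 - s K * d K) where
  d_mul_s := d_mul_s K
  s_mul_d := (sub_sub_cancel (1 : IntegroDiff K) (s K * d K)).symm
  d_mul_h := by
    rw [d_mul_x, mul_add, mul_one, ← mul_assoc, d_mul_x]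
    noncomm_ring
  h_mul_s := by
    refine ext_monomial K fun n c => ?_
    have hn : (n : K) + 1 ≠ 0 := Nat.cast_add_one_ne_zero n
    rw [mul_apply, mul_apply, mul_apply, add_apply, mul_apply, one_apply, d_apply, s_apply, s_apply,
      x_apply, x_apply, d_apply, X_mul_monomial, derivative_monomial_succ, ← (monomial n).map_add,
      polyIntegral_monomial, polyIntegral_monomial, X_mul_monomial, derivative_monomial_succ]
    congr 1
    push_cast
    field_simp
  e_mul_h := by
    refine ext K fun p => ?_
    rw [mul_apply, one_sub_s_mul_d_apply, one_sub_s_mul_d_apply, mul_apply, d_apply, x_apply,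
      coeff_derivative, coeff_X_mul]
    simp
  h_mul_e := by
    refine ext K fun p => ?_
    rw [mul_apply, mul_apply, d_apply, x_apply, one_sub_s_mul_d_apply, derivative_mul, derivative_X, derivative_C, one_mul, mul_zero,
      add_zero]
  e_ne_zero := by
    intro h
    have h1 := one_sub_s_mul_d_apply K (1 : K[X])
    rw [h] at h1
    simp at h1
  adjoin_eq_top := by
    rw [_root_.eq_top_iff, ← adjoin_eq_top K, Algebra.adjoin_le_iff]
    rintro y (rfl | rfl | rfl)
    · have h1 : x K = s K * (d K * x K) := by
        refine ext K fun p => ?_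
        rw [← mul_assoc]
        rw [mul_apply, s_mul_d_apply, x_apply, coeff_X_mul_zero, C_0, sub_zero]
      exact Set.mem_of_eq_of_mem h1 (SetLike.mem_coe.2
        (mul_mem (Algebra.subset_adjoin (by simp)) (Algebra.subset_adjoin (by simp))))
    · exact Algebra.subset_adjoin (by simp)
    · exact Algebra.subset_adjoin (by simp)

end IntegroDiff

theorem theorem4p4 (K : Type*) [Field K] [CharZero K] :
    IsLeftCoherentRing (IntegroDiff K) ∧ IsRightCoherentRing (IntegroDiff K) :=
  ⟨(IntegroDiff.isIntegroDiffSystem K).isLeftCoherentRing,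
    (IntegroDiff.isIntegroDiffSystem K).op.isLeftCoherentRing.isRightCoherentRing⟩
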